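/- Let $S_n$ be the set of permutations $\pi=\pi_1\pi_2\cdots\pi_n$ of $\{1,\dots,n\}$, written in one-line notation. The topdrop map $T\colon S_n\to S_n$ reverses the first $\pi_1$ entries and moves them to the end: if $k=\pi_1$, then $$T(\pi_1\pi_2\cdots\pi_n)=\pi_{k+1}\pi_{k+2}\cdots\pi_n\,\pi_k\pi_{k-1}\cdots\pi_1 .$$ The map $T$ is a bijection. The orbit of $\pi$ is the cyclic sequence $(\pi,T(\pi),\dots,T^{s-1}(\pi))$, where $s$ is the least positive integer with $T^s(\pi)=\pi$; $s$ is the size of the orbit. Theorem. The following is true of the topdrop map in $S_n$. 1. If $n\ge 2$, there are exactly $(n-2)!$ orbits of size two. 2. There are no orbits of size three (for any $n$). 3. If $n\ge 3$, there are exactly $(n-2)!$ orbits of size four. 4. If $n\ge 7$, the number of orbits of size five is exactly $(n-6)(n-5)!$ if $n$ is even, and exactly $(n-5)(n-5)!$ if $n$ is odd. 5. If $n\ge 4$, the number of orbits of size six is at least $(2n^2-11n+14)(n-4)!$ if $n$ is even, and at least $(2n^2-12n+18)(n-4)!$ if $n$ is odd. 6. If $n\ge 5$, the number of orbits of size eight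 is at least - $\left(\frac32 n^3-\frac{35}{2}n^2+64n-70\right)(n-5)!$ if $n\equiv 0$ or $2\pmod 6$; - $\left(\frac32 n^3-\frac{35}{2}n^2+\frac{137}{2}n-\frac{181}{2}\right)(n-5)!$ if $n\equiv 1\pmod 6$; - $\left(\frac32 n^3-\frac{35}{2}n^2+\frac{135}{2}n-\frac{171}{2}\right)(n-5)!$ if $n\equiv 3$ or $5\pmod 6$; - $\left(\frac32 n^3-\frac{35}{2}n^2+66n-80\right)(n-5)!$ if $n\equiv 4\pmod 6$. -/

import Mathlib

open scoped Nat

/-- The rearrangement of positions (numbered from `0`) used when the top `k` of `n` cards are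
reversed and moved to the end: position `i` of the new deck holds the card that was at position
`i + k` if there is one, and otherwise the card that was at position `n - 1 - i`. -/
def dropPerm (n k : ℕ) : Equiv.Perm (Fin n) where
  toFun i := if h : i.val + k < n then ⟨i.val + k, h⟩ else ⟨n - 1 - i.val, by omega⟩
  invFun j := if j.val < k then ⟨n - 1 - j.val, by omega⟩ else ⟨j.val - k, by omega⟩
  left_inv i := by
    have hi := i.isLt
    by_cases h : i.val + k < n
    · simp [h]
    · have h' : n - 1 - i.val < k := by omega
      apply Fin.ext
      simp only [h, dite_false, h', if_true]
      omega
  right_inv j := by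
    have hj := j.isLt
    by_cases h : j.val < k
    · have h' : ¬ n - 1 - j.val + k < n := by omega
      apply Fin.ext
      simp only [h, if_true, h', dite_false]
      omega
    · have h' : j.val - k + k < n := by omega
      apply Fin.ext
      simp only [h, if_false, h', dite_true]
      omega

/-- The first entry `π₁ ∈ {1, …, n}` of a permutation. The permutation with one-line notation
`π₁ π₂ … πₙ` is represented by the `π : Equiv.Perm (Fin n)` with `(π i).val + 1 = π_{i+1}`.
(The value for `n = 0` is `0`.) -/
def firstEntry {n : ℕ} (π : Equiv.Perm (Fin n)) : ℕ :=
  if h : 0 < n then (π ⟨0, h⟩).val + 1 else 0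

/-- The topdrop map `T`: with `k = π₁`, it sends `π₁ … πₙ` to `π_{k+1} … πₙ π_k … π₁`. -/
def topdrop {n : ℕ} (π : Equiv.Perm (Fin n)) : Equiv.Perm (Fin n) :=
  (dropPerm n (firstEntry π)).trans π

/-- The number of orbits of size `s` of the topdrop map on `S_n`, an orbit being the cyclic
sequence `(π, T π, …, T^{s-1} π)`, where `s` is the least positive integer with `T^s π = π`. -/
noncomputable def numOrbits (n s : ℕ) : ℕ :=
  Set.ncard {O : Cycle (Equiv.Perm (Fin n)) |
    (∃ π : Equiv.Perm (Fin n), O = Function.periodicOrbit topdrop π) ∧ O.length = s}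

/-! Write `T` for the topdrop map and `R` for the reversal of a deck. The identity `T R T = R`
(`topdrop_revDeck_topdrop`) shows that `R` turns `T` into its inverse. Call a deck symmetric if its
top entry is at least `n - 1`; there `T` agrees with `R`. If a symmetric deck meets another
symmetric deck after `i` drops, then `2 * i` drops restore it (`iterate_two_mul_eq_self`).

Upper bounds come from following the top card around a periodic orbit: its return to the top gives
equations between successive top entries, one for each starting point (`trackPos_return`). These
exclude size three, force a symmetric deck in any orbit of size four, and up to rotation leave the
tops `1, a, n - a, a + 1, n - 1 - a` for size five. The counts for sizes two, four and five then
amount to counting one marked deck per orbit (`numOrbits_eq_card`), described by a few prescribed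
entries (`card_decksWith`).

For sizes six and eight only orbits through symmetric decks are counted, whence the inequalities. A
symmetric deck is prescribed so that the deck three or four drops later is symmetric too. An orbit
contains at most two symmetric decks (`card_le_two_mul_numOrbits`), and the two possible top entries
`n - 1` and `n` of the starting deck cancel this factor two (`sum_le_numOrbits`). -/

open Function

/-! ### Entries of a deck and the effect of one drop -/

/-- The entry, in `{1, …, n}`, at position `i` (numbered from `0`); it is `0` off the deck. -/
def entry {n : ℕ} (π : Equiv.Perm (Fin n)) (i : ℕ) : ℕ :=
  if h : i < n then (π ⟨i, h⟩).val + 1 else 0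

lemma entry_pos {n : ℕ} (π : Equiv.Perm (Fin n)) {i : ℕ} (hi : i < n) : 1 ≤ entry π i := by
  simp [entry, hi]

lemma entry_le {n : ℕ} (π : Equiv.Perm (Fin n)) (i : ℕ) : entry π i ≤ n := by
  unfold entry
  split <;> omega

lemma entry_inj {n : ℕ} (π : Equiv.Perm (Fin n)) {i j : ℕ} (hi : i < n) (hj : j < n)
    (h : entry π i = entry π j) : i = j := by
  simp only [entry, hi, hj, dite_true, Nat.add_right_cancel_iff] at h
  simpa using π.injective (Fin.ext h)

lemma perm_ext_entry {n : ℕ} {π σ : Equiv.Perm (Fin n)}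
    (h : ∀ i < n, entry π i = entry σ i) : π = σ := by
  ext i
  have := h i i.isLt
  simpa [entry] using this

lemma firstEntry_eq {n : ℕ} (π : Equiv.Perm (Fin n)) : firstEntry π = entry π 0 := rfl

lemma entry_topdrop {n : ℕ} (π : Equiv.Perm (Fin n)) {i : ℕ} (hi : i < n) :
    entry (topdrop π) i =
      if i + entry π 0 < n then entry π (i + entry π 0) else entry π (n - 1 - i) := by
  have h2 : n - 1 - i < n := by omega
  unfold topdrop
  rw [firstEntry_eq]
  generalize entry π 0 = k
  by_cases h : i + k < n
  · simp [entry, hi, dropPerm, h]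
  · simp [entry, hi, dropPerm, h, h2]

/-- The position, after the top `k` of `n` cards are dropped, of the card at position `x`. -/
def dropPos (n k x : ℕ) : ℕ := if x < k then n - 1 - x else x - k

lemma dropPos_lt {n k x : ℕ} (hx : x < n) : dropPos n k x < n := by
  unfold dropPos
  split <;> omega

lemma entry_topdrop_dropPos {n : ℕ} (π : Equiv.Perm (Fin n)) {x : ℕ} (hx : x < n) :
    entry (topdrop π) (dropPos n (entry π 0) x) = entry π x := by
  rw [entry_topdrop π (dropPos_lt hx)]
  have := entry_le π 0
  unfold dropPos
  generalize entry π 0 = k at *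
  split_ifs <;> first | omega | (congr 1; omega)

/-! ### Reversal and points of symmetry -/

/-- The deck read from bottom to top. -/
def revDeck {n : ℕ} (π : Equiv.Perm (Fin n)) : Equiv.Perm (Fin n) := Fin.revPerm.trans π

lemma entry_revDeck {n : ℕ} (π : Equiv.Perm (Fin n)) {i : ℕ} (hi : i < n) :
    entry (revDeck π) i = entry π (n - 1 - i) := by
  have h2 : n - 1 - i < n := by omega
  simp only [entry, revDeck, hi, h2, dite_true, Equiv.trans_apply, Fin.revPerm_apply]
  congr 3
  apply Fin.ext
  simp only [Fin.val_rev]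
  omega

/-- With `k = π₁`, the reversal of `T π` is `π₁ … π_k πₙ … π_{k+1}`. Its top entry is again `k`, so
the next drop gives `πₙ … π₁`. -/
lemma topdrop_revDeck_topdrop {n : ℕ} (π : Equiv.Perm (Fin n)) :
    topdrop (revDeck (topdrop π)) = revDeck π := by
  apply perm_ext_entry
  intro i hi
  have h0 : entry (revDeck (topdrop π)) 0 = entry π 0 := by
    rw [entry_revDeck _ (by omega), entry_topdrop _ (by omega)]
    have := entry_pos π (show 0 < n by omega)
    rw [if_neg (by omega)]
    congr 1
    omega
  have := entry_le π 0
  rw [entry_topdrop _ hi, h0, entry_revDeck π hi]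
  generalize hk : entry π 0 = k at *
  split_ifs with h
  · rw [entry_revDeck _ h, entry_topdrop _ (by omega), hk, if_pos (by omega)]
    congr 1
    omega
  · rw [entry_revDeck _ (by omega), entry_topdrop _ (by omega), hk, if_neg (by omega)]
    congr 1
    omega

lemma topdrop_injective {n : ℕ} : Injective (topdrop (n := n)) := by
  intro π σ h
  have h1 : revDeck π = revDeck σ := by
    rw [← topdrop_revDeck_topdrop, h, topdrop_revDeck_topdrop]
  ext i
  have := congrArg (fun τ => (τ (Fin.rev i)).val) h1
  simpa [revDeck] using this

lemma iterate_revDeck_iterate {n : ℕ} (j : ℕ) (π : Equiv.Perm (Fin n)) :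
    topdrop^[j] (revDeck (topdrop^[j] π)) = revDeck π := by
  induction j generalizing π with
  | zero => rfl
  | succ j ih =>
    rw [iterate_succ_apply', iterate_succ_apply, ih, topdrop_revDeck_topdrop]

lemma topdrop_eq_revDeck {n : ℕ} {π : Equiv.Perm (Fin n)} (h : n - 1 ≤ entry π 0) :
    topdrop π = revDeck π := by
  apply perm_ext_entry
  intro i hi
  rw [entry_topdrop _ hi, entry_revDeck _ hi]
  split_ifs
  · congr 1
    omega
  · rfl

/-- A deck `π` with `T π` the reversal of `π` is a point of symmetry of its orbit. -/
lemma iterate_two_mul_eq_self {n : ℕ} {π : Equiv.Perm (Fin n)} {i : ℕ} (h : n - 1 ≤ entry π 0)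
    (hi : n - 1 ≤ entry (topdrop^[i] π) 0) : topdrop^[2 * i] π = π := by
  -- In `T^i R T^i π = R π`, both occurrences of `R` act on symmetric decks and may be replaced by
  -- `T`, giving `T^(2i+1) π = T π`.
  apply topdrop_injective
  have h1 := iterate_revDeck_iterate i π
  rw [← topdrop_eq_revDeck h, ← topdrop_eq_revDeck hi, ← iterate_succ_apply' topdrop i,
    ← iterate_add_apply] at h1
  rw [← iterate_succ_apply' topdrop, ← h1]
  rw [show 2 * i = i + i by omega]
  rfl

/-! ### Counting orbits through marked decks -/

lemma mem_periodicPts_topdrop {n : ℕ} (π : Equiv.Perm (Fin n)) : π ∈ periodicPts topdrop :=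
  topdrop_injective.mem_periodicPts π

lemma numOrbits_eq_card_image (n s : ℕ) :
    numOrbits n s = (Finset.image (periodicOrbit topdrop)
      {π : Equiv.Perm (Fin n) | minimalPeriod topdrop π = s}).card := by
  rw [← Set.ncard_coe_finset]
  unfold numOrbits
  congr 1
  ext O
  simp only [Set.mem_ofPred_eq, Finset.coe_image, Set.mem_image, Finset.coe_filter,
    Finset.mem_univ, true_and]
  constructor
  · rintro ⟨⟨π, rfl⟩, h⟩
    exact ⟨π, by simpa using h, rfl⟩
  · rintro ⟨π, h, rfl⟩
    exact ⟨⟨π, rfl⟩, by simpa using h⟩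

lemma exists_iterate_eq_of_periodicOrbit_eq {n : ℕ} {π σ : Equiv.Perm (Fin n)}
    (h : periodicOrbit topdrop π = periodicOrbit topdrop σ) :
    ∃ i < minimalPeriod topdrop π, topdrop^[i] π = σ := by
  have h1 : σ ∈ periodicOrbit topdrop π := by
    rw [h]
    exact self_mem_periodicOrbit (mem_periodicPts_topdrop σ)
  obtain ⟨i, hi⟩ := (mem_periodicOrbit_iff (mem_periodicPts_topdrop π)).1 h1
  exact ⟨i % minimalPeriod topdrop π,
    Nat.mod_lt _ (minimalPeriod_pos_of_mem_periodicPts (mem_periodicPts_topdrop π)),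
    by rw [iterate_mod_minimalPeriod_eq, hi]⟩

lemma numOrbits_eq_card {n s : ℕ} (A : Finset (Equiv.Perm (Fin n)))
    (hA : ∀ π ∈ A, minimalPeriod topdrop π = s)
    (hit : ∀ π : Equiv.Perm (Fin n), minimalPeriod topdrop π = s → ∃ i, topdrop^[i] π ∈ A)
    (uniq : ∀ π ∈ A, ∀ i < s, topdrop^[i] π ∈ A → i = 0) : numOrbits n s = A.card := by
  have h : Set.InjOn (periodicOrbit topdrop) (A : Set (Equiv.Perm (Fin n))) := by
    intro π hπ σ hσ hh
    obtain ⟨i, hi, rfl⟩ := exists_iterate_eq_of_periodicOrbit_eq hh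
    rw [hA π hπ] at hi
    rw [uniq π hπ i hi hσ]
    rfl
  rw [← Finset.card_image_of_injOn h, numOrbits_eq_card_image]
  congr 1
  ext O
  simp only [Finset.mem_image, Finset.mem_filter, Finset.mem_univ, true_and]
  constructor
  · rintro ⟨π, hπ, rfl⟩
    obtain ⟨i, hi⟩ := hit π hπ
    exact ⟨_, hi, periodicOrbit_apply_iterate_eq (mem_periodicPts_topdrop π) i⟩
  · rintro ⟨π, hπ, rfl⟩
    exact ⟨π, hA π hπ, rfl⟩

/-- Two symmetric decks at distance `i` in an orbit of size `2 * m` satisfy `2 * m ∣ 2 * i`, so they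
coincide or are opposite: each orbit meets `A` at most twice. -/
lemma card_le_two_mul_numOrbits {n m : ℕ} (A : Finset (Equiv.Perm (Fin n)))
    (hA : ∀ π ∈ A, minimalPeriod topdrop π = 2 * m) (hX : ∀ π ∈ A, n - 1 ≤ entry π 0) :
    A.card ≤ 2 * numOrbits n (2 * m) := by
  refine (Finset.card_le_mul_card_image (f := periodicOrbit topdrop) A 2 ?_).trans ?_
  · intro O hO
    obtain ⟨π, hπ, rfl⟩ := Finset.mem_image.1 hO
    refine (Finset.card_le_card (t := {π, topdrop^[m] π}) ?_).trans Finset.card_le_two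
    intro σ hσ
    rw [Finset.mem_filter] at hσ
    obtain ⟨i, hi, rfl⟩ := exists_iterate_eq_of_periodicOrbit_eq hσ.2.symm
    have hd : 2 * m ∣ 2 * i := by
      rw [← hA π hπ]
      exact IsPeriodicPt.minimalPeriod_dvd
        (iterate_two_mul_eq_self (hX π hπ) (hX _ hσ.1))
    rw [hA π hπ] at hi
    obtain ⟨c, hc⟩ := Nat.dvd_of_mul_dvd_mul_left (by norm_num) hd
    have hc2 : c < 2 := by
      by_contra hcon
      have : m * 2 ≤ m * c := Nat.mul_le_mul_left m (by omega)
      omega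
    interval_cases c
    · simp_all
    · simp_all
  · rw [numOrbits_eq_card_image]
    gcongr
    intro π hπ
    simpa using hA π hπ

/-! ### Permutations with prescribed entries -/

/-- The prescribed values give a bijection from the range of `p` to that of `v`; its extensions
correspond to bijections between the complements, which have `n - m` elements. -/
lemma card_perm_eq_on {n m : ℕ} (p v : Fin m → Fin n) (hp : Injective p) (hv : Injective v) :
    Fintype.card {π : Equiv.Perm (Fin n) // ∀ i, π (p i) = v i} = (n - m)! := by
  classical
  let e₀ : Set.range p ≃ Set.range v := (Equiv.ofInjective p hp).symm.trans (Equiv.ofInjective v hv)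
  have he (i : Fin m) : e₀ ⟨p i, i, rfl⟩ = ⟨v i, i, rfl⟩ := by
    have h := Equiv.ofInjective_symm_apply hp i
    simp only [e₀, Equiv.trans_apply, h]
    rfl
  have hc {w : Fin m → Fin n} (hw : Injective w) :
      Fintype.card ((Set.range w)ᶜ : Set (Fin n)) = n - m := by
    rw [Fintype.card_compl_set, Set.card_range_of_injective hw, Fintype.card_fin, Fintype.card_fin]
  have e : ((Set.range p)ᶜ : Set (Fin n)) ≃ ((Set.range v)ᶜ : Set (Fin n)) :=
    Fintype.equivOfCardEq ((hc hp).trans (hc hv).symm)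
  rw [← hc hp, ← Fintype.card_equiv e, ← Fintype.card_congr (Equiv.Set.compl e₀)]
  refine Fintype.card_congr (Equiv.subtypeEquivRight fun π => ?_)
  constructor
  · rintro h ⟨_, i, rfl⟩
    rw [he, h]
  · intro h i
    rw [h ⟨p i, i, rfl⟩, he]

lemma card_entry_eq {n : ℕ} (L : List (ℕ × ℕ)) (h1 : (L.map Prod.fst).Nodup)
    (h2 : (L.map Prod.snd).Nodup) (h3 : ∀ q ∈ L, q.1 < n ∧ 1 ≤ q.2 ∧ q.2 ≤ n) :
    (Finset.univ.filter fun π : Equiv.Perm (Fin n) => ∀ q ∈ L, entry π q.1 = q.2).card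
      = (n - L.length)! := by
  have hL (i : Fin L.length) := h3 _ (L.get_mem i)
  have hp : Injective fun i : Fin L.length => (⟨(L.get i).1, (hL i).1⟩ : Fin n) := by
    intro i j hij
    have h := List.nodup_iff_injective_get.1 h1 (a₁ := i.cast (by simp)) (a₂ := j.cast (by simp))
      (by simpa using hij)
    simpa [Fin.ext_iff] using h
  have hv : Injective fun i : Fin L.length =>
      (⟨(L.get i).2 - 1, by have := hL i; omega⟩ : Fin n) := by
    intro i j hij
    have h := List.nodup_iff_injective_get.1 h2 (a₁ := i.cast (by simp)) (a₂ := j.cast (by simp))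
      (by
        have := hL i
        have := hL j
        simp only [Fin.mk.injEq, List.get_eq_getElem] at *
        simp
        omega)
    simpa [Fin.ext_iff] using h
  rw [← card_perm_eq_on _ _ hp hv, Fintype.card_subtype]
  congr 1
  ext π
  simp only [Finset.mem_filter, Finset.mem_univ, true_and]
  constructor
  · intro h i
    have h4 := h _ (L.get_mem i)
    have := hL i
    simp only [entry, this.1, dite_true] at h4
    apply Fin.ext
    simp only
    omega
  · intro h q hq
    obtain ⟨i, rfl⟩ := List.get_of_mem hq
    have h4 := congrArg Fin.val (h i)
    have := hL i
    simp only [entry, this.1, dite_true]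
    simp only at h4
    omega

/-! ### Following a card through several drops -/

/-- The top entry after `t` steps. -/
def topEntry {n : ℕ} (π : Equiv.Perm (Fin n)) (t : ℕ) : ℕ := entry (topdrop^[t] π) 0

/-- The position after `t` steps, with successive top entries `k 0, k 1, …`, of the card that
starts at position `x`. -/
def trackPos (n : ℕ) (k : ℕ → ℕ) (x : ℕ) : ℕ → ℕ
  | 0 => x
  | t + 1 => dropPos n (k t) (trackPos n k x t)

lemma trackPos_lt {n : ℕ} (k : ℕ → ℕ) {x : ℕ} (hx : x < n) (t : ℕ) : trackPos n k x t < n := by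
  induction t with
  | zero => exact hx
  | succ t ih => exact dropPos_lt ih

lemma topEntry_iterate {n : ℕ} (π : Equiv.Perm (Fin n)) (i t : ℕ) :
    topEntry (topdrop^[i] π) t = topEntry π (t + i) := by
  rw [topEntry, topEntry, iterate_add_apply]

lemma topEntry_pos {n : ℕ} (hn : 0 < n) (π : Equiv.Perm (Fin n)) (t : ℕ) : 1 ≤ topEntry π t :=
  entry_pos _ hn

lemma topEntry_le {n : ℕ} (π : Equiv.Perm (Fin n)) (t : ℕ) : topEntry π t ≤ n :=
  entry_le _ _

lemma entry_iterate_trackPos {n : ℕ} (π : Equiv.Perm (Fin n)) {x : ℕ} (hx : x < n) (t : ℕ) :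
    entry (topdrop^[t] π) (trackPos n (topEntry π) x t) = entry π x := by
  induction t with
  | zero => rfl
  | succ t ih =>
    rw [iterate_succ_apply', ← ih]
    exact entry_topdrop_dropPos _ (trackPos_lt _ hx t)

lemma trackPos_eq {n : ℕ} {π : Equiv.Perm (Fin n)} {x y t : ℕ} (hx : x < n) (hy : y < n)
    (h : entry (topdrop^[t] π) y = entry π x) : trackPos n (topEntry π) x t = y :=
  entry_inj _ (trackPos_lt _ hx t) hy (by rw [entry_iterate_trackPos π hx, h])

lemma trackPos_topEntry_eq_zero {n : ℕ} {π : Equiv.Perm (Fin n)} {i t : ℕ} (hn : 0 < n)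
    (h : topEntry π (t + i) = topEntry π i) :
    trackPos n (fun u => topEntry π (u + i)) 0 t = 0 := by
  have h1 := trackPos_eq (π := topdrop^[i] π) (t := t) hn hn
    (by rw [← iterate_add_apply]; exact h)
  rwa [show topEntry (topdrop^[i] π) = fun u => topEntry π (u + i) from
    funext (topEntry_iterate π i)] at h1

lemma topEntry_add_period {n s : ℕ} {π : Equiv.Perm (Fin n)} (h : topdrop^[s] π = π) (t : ℕ) :
    topEntry π (t + s) = topEntry π t := by
  rw [← topEntry_iterate, h]

lemma trackPos_return {n s : ℕ} {π : Equiv.Perm (Fin n)} (hn : 0 < n) (h : topdrop^[s] π = π)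
    (i : ℕ) : trackPos n (fun u => topEntry π (u + i)) 0 s = 0 :=
  trackPos_topEntry_eq_zero hn (by rw [Nat.add_comm]; exact topEntry_add_period h i)

lemma topEntry_one_ne {n : ℕ} (hn : 2 ≤ n) (π : Equiv.Perm (Fin n)) (i : ℕ) :
    topEntry π (1 + i) ≠ topEntry π i := by
  intro h
  have h1 := trackPos_topEntry_eq_zero (by omega) h
  have := topEntry_pos (by omega) π i
  simp only [trackPos, dropPos, Nat.zero_add] at h1
  split_ifs at h1 <;> omega

/-- Two drops send the top card first to the bottom, then to position `n - 1 - topEntry π (1 + i)`,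
which is not yet the top. -/
lemma topEntry_two_ne {n : ℕ} {π : Equiv.Perm (Fin n)} {i : ℕ}
    (h1 : topEntry π (1 + i) < n - 1) : topEntry π (2 + i) ≠ topEntry π i := by
  intro h
  have h1 := trackPos_topEntry_eq_zero (by omega) h
  have := topEntry_pos (by omega) π i
  simp only [trackPos, dropPos, Nat.zero_add] at h1
  split_ifs at h1 <;> omega

lemma iterate_one_ne {n : ℕ} (hn : 2 ≤ n) (π : Equiv.Perm (Fin n)) : topdrop^[1] π ≠ π :=
  fun h => topEntry_one_ne hn π 0 (by rw [Nat.add_comm]; exact topEntry_add_period h 0)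

/-- The top card returns after three drops only if the next two top entries sum to `n - 1`. Applied
from all three starting points, this makes the top entries equal, whereas consecutive ones differ.
-/
lemma iterate_three_ne {n : ℕ} (hn : 2 ≤ n) (π : Equiv.Perm (Fin n)) : topdrop^[3] π ≠ π := by
  intro h
  have hp := topEntry_add_period h
  have hr := trackPos_return (by omega) h
  have hne := topEntry_one_ne hn π
  have h0 := topEntry_pos (by omega) π
  have hl := topEntry_le π
  have r0 := hr 0
  have r1 := hr 1
  have r2 := hr 2
  have e3 := hp 0
  have e4 := hp 1
  have e5 := hp 2
  have n0 := hne 0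
  have n1 := hne 1
  have n2 := hne 2
  simp only [trackPos, Nat.zero_add, Nat.reduceAdd, e3, e4, e5, dropPos] at *
  have a0 := h0 0
  have a1 := h0 1
  have a2 := h0 2
  have b0 := hl 0
  have b1 := hl 1
  have b2 := hl 2
  clear h0 hl hne hp hr
  grind

lemma minimalPeriod_eq_of {n s : ℕ} {π : Equiv.Perm (Fin n)} (h : minimalPeriod topdrop π = s) :
    topdrop^[s] π = π := by
  rw [← h]
  exact iterate_minimalPeriod

lemma numOrbits_three (n : ℕ) : numOrbits n 3 = 0 := by
  rw [numOrbits_eq_card (n := n) (s := 3) ∅ (by simp) ?_ (by simp), Finset.card_empty]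
  intro π h
  by_cases hn : 2 ≤ n
  · exact absurd (minimalPeriod_eq_of h) (iterate_three_ne hn π)
  · have : Subsingleton (Fin n) := Fin.subsingleton_iff_le_one.2 (by omega)
    have h1 : topdrop π = π := Subsingleton.elim _ _
    rw [minimalPeriod_eq_one_iff_isFixedPt.2 h1] at h
    omega

/-! ### Orbits of sizes two and four -/

lemma entry_bottom_topdrop {n : ℕ} (π : Equiv.Perm (Fin n)) (hn : 0 < n) :
    entry (topdrop π) (n - 1) = entry π 0 := by
  have := entry_pos π hn
  rw [entry_topdrop _ (by omega), if_neg (by omega), Nat.sub_self]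

lemma topEntry_one_of_le {n : ℕ} {π : Equiv.Perm (Fin n)} (hn : 0 < n)
    (h : n - 1 ≤ entry π 0) : topEntry π 1 = entry π (n - 1) := by
  rw [topEntry, iterate_one, topdrop_eq_revDeck h, entry_revDeck _ hn, Nat.sub_zero]

/-- The return equations force the two top entries to be `n` and `n - 1`; the deck topped by `n`
represents the orbit. -/
lemma numOrbits_two {n : ℕ} (hn : 2 ≤ n) : numOrbits n 2 = (n - 2)! := by
  have hc := card_entry_eq (n := n) [(0, n), (n - 1, n - 1)]
    (by simp; omega) (by simp; omega) (by simp; omega)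
  rw [List.length_cons, List.length_singleton] at hc
  rw [← hc]
  have key {π : Equiv.Perm (Fin n)} (h0 : entry π 0 = n) (h1 : entry π (n - 1) = n - 1) :
      topEntry π 1 = n - 1 := by
    rw [topEntry_one_of_le (by omega) (by omega), h1]
  apply numOrbits_eq_card
  · intro π hπ
    simp at hπ
    have h1 := key hπ.1 hπ.2
    exact minimalPeriod_eq_prime (p := 2) (iterate_two_mul_eq_self (i := 1) (by omega) h1.ge)
      (iterate_one_ne hn π)
  · intro π h
    have hp := topEntry_add_period (minimalPeriod_eq_of h)
    have r0 := trackPos_return (by omega) (minimalPeriod_eq_of h) 0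
    have r1 := trackPos_return (by omega) (minimalPeriod_eq_of h) 1
    have n0 := topEntry_one_ne hn π 0
    have a0 := topEntry_pos (by omega) π 0
    have a1 := topEntry_pos (by omega) π 1
    have b0 := topEntry_le π 0
    have b1 := topEntry_le π 1
    have e2 := hp 0
    simp only [trackPos, Nat.zero_add, Nat.reduceAdd, e2, dropPos] at *
    have hX (σ : Equiv.Perm (Fin n)) (h0 : entry σ 0 = n) :
        entry σ (n - 1) = topEntry σ 1 := (topEntry_one_of_le (by omega) (by omega)).symm
    have hk : (topEntry π 0 = n ∧ topEntry π 1 = n - 1) ∨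
        (topEntry π 1 = n ∧ topEntry π 0 = n - 1) := by
      split_ifs at r0 r1 <;> omega
    rcases hk with ⟨h0, h1⟩ | ⟨h0, h1⟩
    · refine ⟨0, ?_⟩
      simp
      exact ⟨h0, (hX π h0).trans h1⟩
    · refine ⟨1, ?_⟩
      simp
      exact ⟨h0, (hX _ h0).trans ((hp 0).trans h1)⟩
  · intro π hπ i hi hh
    simp at hπ hh
    have h1 := key hπ.1 hπ.2
    interval_cases i
    · rfl
    · have := hh.1
      simp only [topEntry] at h1
      omega

/-- The decks which, for some `i ∈ S`, have the entries prescribed by the list `L i` of pairs of a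
position and a value. -/
def decksWith {ι : Type*} (n : ℕ) (S : Finset ι) (L : ι → List (ℕ × ℕ)) :
    Finset (Equiv.Perm (Fin n)) :=
  open Classical in Finset.univ.filter fun π => ∃ i ∈ S, ∀ q ∈ L i, entry π q.1 = q.2

lemma mem_decksWith {ι : Type*} {n : ℕ} {S : Finset ι} {L : ι → List (ℕ × ℕ)}
    {π : Equiv.Perm (Fin n)} :
    π ∈ decksWith n S L ↔ ∃ i ∈ S, ∀ q ∈ L i, entry π q.1 = q.2 := by
  simp [decksWith]

lemma card_decksWith {ι : Type*} {n : ℕ} {S : Finset ι} {L : ι → List (ℕ × ℕ)}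
    (h1 : ∀ i ∈ S, ((L i).map Prod.fst).Nodup) (h2 : ∀ i ∈ S, ((L i).map Prod.snd).Nodup)
    (h3 : ∀ i ∈ S, ∀ q ∈ L i, q.1 < n ∧ 1 ≤ q.2 ∧ q.2 ≤ n)
    (h4 : ∀ i ∈ S, ∀ j ∈ S, ∀ π : Equiv.Perm (Fin n), (∀ q ∈ L i, entry π q.1 = q.2) →
      (∀ q ∈ L j, entry π q.1 = q.2) → i = j) :
    (decksWith n S L).card = ∑ i ∈ S, (n - (L i).length)! := by
  classical
  have h : decksWith n S L = S.biUnion fun i =>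
      Finset.univ.filter fun π : Equiv.Perm (Fin n) => ∀ q ∈ L i, entry π q.1 = q.2 := by
    ext π
    simp [mem_decksWith]
  rw [h, Finset.card_biUnion]
  · exact Finset.sum_congr rfl fun i hi => card_entry_eq _ (h1 i hi) (h2 i hi) (h3 i hi)
  · intro i hi j hj hij
    refine Finset.disjoint_left.2 fun π hπ hπ' => ?_
    exact hij (h4 i hi j hj π (by simpa using hπ) (by simpa using hπ'))

lemma topEntry_succ {n : ℕ} (π : Equiv.Perm (Fin n)) (t : ℕ) :
    topEntry π (t + 1) = topEntry (topdrop π) t := rfl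

lemma topEntry_one_of_lt {n : ℕ} {π : Equiv.Perm (Fin n)} (h : entry π 0 < n) :
    topEntry π 1 = entry π (entry π 0) := by
  rw [topEntry, iterate_one, entry_topdrop _ (by omega), Nat.zero_add, if_pos h]

lemma topEntry_two_of_lt {n : ℕ} {π : Equiv.Perm (Fin n)} (h : topEntry π 1 < n) :
    topEntry π 2 = if topEntry π 1 + entry π 0 < n then entry π (topEntry π 1 + entry π 0)
      else entry π (n - 1 - topEntry π 1) := by
  exact (topEntry_one_of_lt (π := topdrop π) h).trans (entry_topdrop _ h)

lemma topEntry_three_of_lt {n : ℕ} {π : Equiv.Perm (Fin n)} (h : topEntry π 2 < n) :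
    topEntry π 3 = if topEntry π 2 + topEntry π 1 < n
      then entry (topdrop π) (topEntry π 2 + topEntry π 1)
      else entry (topdrop π) (n - 1 - topEntry π 2) := by
  exact topEntry_two_of_lt (π := topdrop π) h

/-- Reversal reflects an orbit about its symmetric decks. Hence the top entries read the same in
both directions (`topEntry_sub`), and the deck opposite a symmetric one is symmetric
(`le_topEntry_half`). -/
lemma revDeck_iterate {n s j : ℕ} {π : Equiv.Perm (Fin n)} (hX : n - 1 ≤ entry π 0)
    (h : topdrop^[s] π = π) (hj : j ≤ s + 1) :
    revDeck (topdrop^[j] π) = topdrop^[s + 1 - j] π := by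
  apply topdrop_injective.iterate j
  rw [iterate_revDeck_iterate, ← topdrop_eq_revDeck hX, ← iterate_add_apply,
    Nat.add_sub_cancel' hj, iterate_succ_apply', h]

lemma topEntry_sub {n s j : ℕ} {π : Equiv.Perm (Fin n)} (hX : n - 1 ≤ entry π 0)
    (h : topdrop^[s] π = π) (hj : j ≤ s) : topEntry π (s - j) = topEntry π j := by
  rcases Nat.eq_zero_or_pos n with rfl | hn
  · simp [topEntry, entry]
  have h1 : entry _ (n - 1) = entry _ (n - 1) :=
    congrArg (entry · (n - 1)) (revDeck_iterate hX h (hj.trans s.le_succ))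
  rw [entry_revDeck _ (by omega), Nat.sub_self, show s + 1 - j = s - j + 1 by omega,
    iterate_succ_apply', entry_bottom_topdrop _ hn] at h1
  exact h1.symm

lemma le_topEntry_half {n m : ℕ} {π : Equiv.Perm (Fin n)} (hn : 2 ≤ n) (hX : n - 1 ≤ entry π 0)
    (h : topdrop^[2 * m] π = π) : n - 1 ≤ topEntry π m := by
  have h1 : entry _ 0 = entry _ 0 := congrArg (entry · 0) (revDeck_iterate hX h (j := m) (by omega))
  rw [entry_revDeck _ (by omega), show 2 * m + 1 - m = m + 1 by omega, iterate_succ_apply',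
    entry_topdrop _ (by omega)] at h1
  split_ifs at h1 with h2
  · exact (entry_inj _ (by omega) h2 h1).le.trans (by rw [Nat.zero_add]; rfl)
  · unfold topEntry
    omega

lemma trackPos_two {n : ℕ} {k : ℕ → ℕ} (h0 : 1 ≤ k 0) (h1 : k 1 ≤ n - 1) :
    trackPos n k 0 2 = n - 1 - k 1 := by
  have h2 : trackPos n k 0 1 = n - 1 := if_pos h0
  have h3 : trackPos n k 0 2 = dropPos n (k 1) (trackPos n k 0 1) := rfl
  rw [h3, h2, dropPos, if_neg (by omega)]

lemma exists_le_topEntry_of_iterate_four {n : ℕ} (hn : 2 ≤ n) {π : Equiv.Perm (Fin n)}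
    (h : topdrop^[4] π = π) : ∃ i < 4, n - 1 ≤ topEntry π i := by
  by_contra! hlt
  have hp := topEntry_add_period h
  have e4 : topEntry π 4 = topEntry π 0 := hp 0
  have e5 : topEntry π 5 = topEntry π 1 := hp 1
  have e6 : topEntry π 6 = topEntry π 2 := hp 2
  have a0 := hlt 0 (by omega)
  have a1 := hlt 1 (by omega)
  have a2 := hlt 2 (by omega)
  have a3 := hlt 3 (by omega)
  have n0 : topEntry π 2 ≠ topEntry π 0 := topEntry_two_ne (i := 0) a1
  have n1 : topEntry π 3 ≠ topEntry π 1 := topEntry_two_ne (i := 1) a2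
  have b0 := topEntry_pos (by omega) π 0
  have b1 := topEntry_pos (by omega) π 1
  have b2 := topEntry_pos (by omega) π 2
  have b3 := topEntry_pos (by omega) π 3
  -- The third drop puts the card at `k 1` or at `n - 1 - k 1 - k 2`, and the fourth brings it to
  -- the top only from position `k 3`. The first option is barred by `k 1 ≠ k 3`. Three shifts of
  -- the resulting equation make the top entries at times 0, 1 and 2 equal.
  have key {k : ℕ → ℕ} (h0 : 1 ≤ k 0) (h1 : 1 ≤ k 1) (h1' : k 1 < n - 1) (h2 : 1 ≤ k 2)
      (h3 : 1 ≤ k 3) (h3' : k 3 < n - 1) (hne : k 1 ≠ k 3)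
      (hr : trackPos n k 0 4 = 0) : k 1 + k 2 + k 3 = n - 1 := by
    have hr' : dropPos n (k 3) (dropPos n (k 2) (n - 1 - k 1)) = 0 := by
      rw [← trackPos_two h0 h1'.le]
      exact hr
    unfold dropPos at hr'
    split_ifs at hr' <;> omega
  have r0 := key b0 b1 a1 b2 b3 a3 n1.symm (trackPos_return (by omega) h 0)
  have r1 := key (k := fun u => topEntry π (u + 1))
  have r2 := key (k := fun u => topEntry π (u + 2))
  simp only [Nat.zero_add, Nat.reduceAdd, e4, e5] at r1 r2
  have r1 := r1 b1 b2 a2 b3 b0 a0 n0 (trackPos_return (by omega) h 1)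
  have r2 := r2 b2 b3 a3 b0 b1 a1 n1 (trackPos_return (by omega) h 2)
  omega

/-- Each such orbit has top entries `n, a, n - 1, a` with `1 ≤ a ≤ n - 2`. The representative starts
at `n`; each `a` leaves `(n - 3)!` decks. -/
lemma numOrbits_four {n : ℕ} (hn : 3 ≤ n) : numOrbits n 4 = (n - 2)! := by
  have hc := card_decksWith (n := n) (S := Finset.Icc 1 (n - 2))
    (L := fun a => [(0, n), (n - 1, a), (n - 1 - a, n - 1)])
    (by intro a ha; simp at ha ⊢; omega) (by intro a ha; simp at ha ⊢; omega)
    (by intro a ha; simp at ha ⊢; omega)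
    (by intro a ha b hb π h h'; simp at h h'; omega)
  rw [Finset.sum_congr rfl (g := fun _ => (n - 3)!) (by simp)] at hc
  rw [Finset.sum_const, Nat.card_Icc, smul_eq_mul,
    show n - 2 + 1 - 1 = (n - 3) + 1 by omega, ← Nat.factorial_succ,
    show n - 3 + 1 = n - 2 by omega] at hc
  rw [← hc]
  have hmem {π : Equiv.Perm (Fin n)} : π ∈ decksWith n (Finset.Icc 1 (n - 2))
      (fun a => [(0, n), (n - 1, a), (n - 1 - a, n - 1)]) ↔
      topEntry π 0 = n ∧ topEntry π 1 ≤ n - 2 ∧ topEntry π 2 = n - 1 := by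
    have hπ (h0 : entry π 0 = n) : topEntry π 1 = entry π (n - 1) :=
      topEntry_one_of_le (by omega) (by omega)
    have hπ' (h0 : entry π 0 = n) (h1 : entry π (n - 1) ≤ n - 2) :
        topEntry π 2 = entry π (n - 1 - entry π (n - 1)) := by
      rw [topEntry_two_of_lt (by rw [hπ h0]; omega), if_neg (by omega), hπ h0]
    have := entry_pos π (i := n - 1) (by omega)
    simp only [mem_decksWith, Finset.mem_Icc, List.forall_mem_cons, List.not_mem_nil,
      false_implies, implies_true, and_true]
    constructor
    · rintro ⟨a, ⟨ha, ha'⟩, h0, h1, h2⟩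
      rw [hπ h0, hπ' h0 (by omega), h1]
      exact ⟨h0, ha', h2⟩
    · rintro ⟨h0, h1, h2⟩
      rw [hπ h0] at h1
      rw [hπ' h0 h1] at h2
      exact ⟨_, ⟨this, h1⟩, h0, rfl, h2⟩
  have htwo {π : Equiv.Perm (Fin n)} (h : topEntry π 2 ≠ topEntry π 0) : topdrop^[2] π ≠ π :=
    fun h2 => h (topEntry_add_period h2 0)
  apply numOrbits_eq_card
  · intro π hπ
    obtain ⟨h0, h1, h2⟩ := hmem.1 hπ
    exact minimalPeriod_eq_prime_pow (p := 2) (k := 1) (htwo (by omega))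
      (iterate_two_mul_eq_self (i := 2) (show n - 1 ≤ topEntry π 0 by omega) h2.ge)
  · intro π h
    obtain ⟨i, -, hi⟩ := exists_le_topEntry_of_iterate_four (by omega) (minimalPeriod_eq_of h)
    have hmin : minimalPeriod topdrop (topdrop^[i] π) = 4 := by
      rw [minimalPeriod_apply_iterate (mem_periodicPts_topdrop π), h]
    suffices h : ∃ j, topdrop^[j] (topdrop^[i] π) ∈ decksWith n (Finset.Icc 1 (n - 2))
        (fun a => [(0, n), (n - 1, a), (n - 1 - a, n - 1)]) by
      obtain ⟨j, hj⟩ := h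
      exact ⟨j + i, by rwa [iterate_add_apply]⟩
    have hi' : n - 1 ≤ topEntry (topdrop^[i] π) 0 := hi
    clear hi h
    generalize topdrop^[i] π = σ at *
    have h4 := minimalPeriod_eq_of hmin
    have e4 : topEntry σ 4 = topEntry σ 0 := topEntry_add_period h4 0
    have e5 : topEntry σ 5 = topEntry σ 1 := topEntry_add_period h4 1
    have hσ1 : topEntry σ 1 ≤ n - 2 := by
      by_contra! hcon
      have h2 : IsPeriodicPt topdrop 2 σ :=
        iterate_two_mul_eq_self (i := 1) hi' (show n - 1 ≤ topEntry σ 1 by omega)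
      have := h2.minimalPeriod_le (by norm_num)
      omega
    have hne : topEntry σ 2 ≠ topEntry σ 0 := topEntry_two_ne (i := 0) (by
      rw [Nat.add_zero]
      omega)
    have h2 : n - 1 ≤ topEntry σ 2 := le_topEntry_half (by omega) hi' h4
    have hσ3 : topEntry σ 3 = topEntry σ 1 := topEntry_sub hi' h4 (j := 1) (by omega)
    have l0 := topEntry_le σ 0
    have l2 := topEntry_le σ 2
    rcases (show topEntry σ 0 = n ∧ topEntry σ 2 = n - 1 ∨
      topEntry σ 2 = n ∧ topEntry σ 0 = n - 1 by omega) with ⟨h0, h2⟩ | ⟨h2, h0⟩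
    · exact ⟨0, hmem.2 ⟨h0, hσ1, h2⟩⟩
    · refine ⟨2, hmem.2 ?_⟩
      rw [topEntry_iterate, topEntry_iterate, topEntry_iterate]
      exact ⟨h2, hσ3.trans_le hσ1, e4.trans h0⟩
  · intro π hπ i hi hi'
    obtain ⟨h0, h1, h2⟩ := hmem.1 hπ
    obtain ⟨h0', h1', h2'⟩ := hmem.1 hi'
    simp only [topEntry_iterate, Nat.zero_add] at h0' h1' h2'
    by_contra hne
    have : i = 1 ∨ i = 2 ∨ i = 3 := by omega
    rcases this with rfl | rfl | rfl
    · omega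
    · omega
    · have h5 :=
        topEntry_add_period
          (iterate_two_mul_eq_self (i := 2) (show n - 1 ≤ topEntry π 0 by omega) h2.ge) 1
      have h5 : topEntry π 5 = topEntry π 1 := h5
      have h2' : topEntry π 5 = n - 1 := h2'
      omega

/-! ### Orbits of size five -/

/-- The ways in which the top card can return to the top after five drops. -/
def FiveReturn (N k1 k2 k3 k4 : ℕ) : Prop :=
  k1 + k2 + k3 + k4 = N ∨ (k1 = k3 + k4 ∧ N < k1 + k2) ∨
    (k4 = k1 + k2 ∧ k1 + k2 ≤ N ∧ N < k1 + k2 + k3) ∨ (k1 + k4 = N ∧ N < k1 + k2 ∧ k1 < k3)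

lemma fiveReturn_of_dropPos {n k1 k2 k3 k4 : ℕ} (h1 : 1 ≤ k1) (h1' : k1 < n - 1) (h2 : 1 ≤ k2)
    (h3 : 1 ≤ k3) (h4 : k4 < n - 1)
    (h : dropPos n k4 (dropPos n k3 (dropPos n k2 (n - 1 - k1))) = 0) :
    FiveReturn (n - 1) k1 k2 k3 k4 := by
  unfold FiveReturn
  unfold dropPos at h
  split_ifs at h <;> omega

-- The five return conditions have four alternatives each; linear arithmetic prunes the tree as soon
-- as two are chosen. The surviving systems are the rotations of a single one.
set_option maxHeartbeats 2000000 in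
lemma five_cycle {N k0 k1 k2 k3 k4 : ℕ} (b0 : 1 ≤ k0) (b1 : 1 ≤ k1) (b2 : 1 ≤ k2) (b3 : 1 ≤ k3)
    (b4 : 1 ≤ k4) (d01 : k0 ≠ k1) (d12 : k1 ≠ k2) (d23 : k2 ≠ k3) (d34 : k3 ≠ k4) (d40 : k4 ≠ k0)
    (d02 : k0 ≠ k2) (d13 : k1 ≠ k3) (d24 : k2 ≠ k4) (d30 : k3 ≠ k0) (d41 : k4 ≠ k1)
    (r0 : FiveReturn N k1 k2 k3 k4) (r1 : FiveReturn N k2 k3 k4 k0)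
    (r2 : FiveReturn N k3 k4 k0 k1) (r3 : FiveReturn N k4 k0 k1 k2)
    (r4 : FiveReturn N k0 k1 k2 k3) :
    (k1 + k4 = N ∧ k2 = k4 + k0 ∧ k3 = k0 + k1) ∨ (k2 + k0 = N ∧ k3 = k0 + k1 ∧ k4 = k1 + k2) ∨
    (k3 + k1 = N ∧ k4 = k1 + k2 ∧ k0 = k2 + k3) ∨ (k4 + k2 = N ∧ k0 = k2 + k3 ∧ k1 = k3 + k4) ∨
    (k0 + k3 = N ∧ k1 = k3 + k4 ∧ k2 = k4 + k0) := by
  rcases r0 with h | h | h | h <;> rcases r1 with h' | h' | h' | h' <;>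
    first
    | (exfalso; omega)
    | (rcases r2 with h | h | h | h <;>
        first
        | (exfalso; omega)
        | (rcases r3 with h' | h' | h' | h' <;>
            first
            | (exfalso; omega)
            | (rcases r4 with h | h | h | h <;> omega)))

/-- From a symmetric deck, reflection would make the deck three drops later its own reversal,
impossible for `n ≥ 2`. -/
lemma topEntry_lt_of_iterate_five {n : ℕ} (hn : 2 ≤ n) {π : Equiv.Perm (Fin n)}
    (h : topdrop^[5] π = π) (i : ℕ) : topEntry π i < n - 1 := by
  by_contra! hX
  have h5 : topdrop^[5] (topdrop^[i] π) = topdrop^[i] π := by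
    rw [← iterate_add_apply, Nat.add_comm, iterate_add_apply, h]
  have h1 : entry _ 0 = entry _ 0 :=
    congrArg (entry · 0) (revDeck_iterate (j := 3) hX h5 (by omega))
  rw [entry_revDeck _ (by omega)] at h1
  have := entry_inj _ (by omega) (by omega) h1
  omega

lemma topEntry_of_iterate_five {n : ℕ} (hn : 2 ≤ n) {π : Equiv.Perm (Fin n)}
    (h : topdrop^[5] π = π) : ∃ i, topEntry π (1 + i) + topEntry π (4 + i) = n - 1 ∧
      topEntry π (2 + i) = topEntry π (4 + i) + topEntry π i ∧
      topEntry π (3 + i) = topEntry π i + topEntry π (1 + i) := by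
  have hp := topEntry_add_period h
  have hlt := topEntry_lt_of_iterate_five hn h
  have hpos := topEntry_pos (by omega) π
  have e5 : topEntry π 5 = topEntry π 0 := hp 0
  have e6 : topEntry π 6 = topEntry π 1 := hp 1
  have e7 : topEntry π 7 = topEntry π 2 := hp 2
  have e8 : topEntry π 8 = topEntry π 3 := hp 3
  have n1 (i : ℕ) := topEntry_one_ne hn π i
  have n2 (i : ℕ) := topEntry_two_ne (hlt (1 + i))
  have r (i : ℕ) : FiveReturn (n - 1) (topEntry π (1 + i)) (topEntry π (2 + i))
      (topEntry π (3 + i)) (topEntry π (4 + i)) := by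
    apply fiveReturn_of_dropPos (hpos _) (hlt _) (hpos _) (hpos _) (hlt _)
    rw [← trackPos_two (k := fun u => topEntry π (u + i)) (hpos _) (hlt _).le]
    exact trackPos_return (by omega) h i
  have n10 := n1 0
  have n11 := n1 1
  have n12 := n1 2
  have n13 := n1 3
  have n14 := n1 4
  have n20 := n2 0
  have n21 := n2 1
  have n22 := n2 2
  have n23 := n2 3
  have n24 := n2 4
  have r0 := r 0
  have r1 := r 1
  have r2 := r 2
  have r3 := r 3
  have r4 := r 4
  simp only [Nat.reduceAdd, e5, e6] at n10 n11 n12 n13 n14 n20 n21 n22 n23 n24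
  simp only [Nat.reduceAdd, e5, e6, e7, e8] at r0 r1 r2 r3 r4
  rcases five_cycle (hpos 0) (hpos 1) (hpos 2) (hpos 3) (hpos 4) n10.symm n11.symm n12.symm
    n13.symm n14.symm n20.symm n21.symm n22.symm n23.symm n24.symm r0 r1 r2 r3 r4
    with h | h | h | h | h
  · exact ⟨0, h⟩
  · exact ⟨1, by simpa only [Nat.reduceAdd, e5, e6, e7, e8] using h⟩
  · exact ⟨2, by simpa only [Nat.reduceAdd, e5, e6, e7, e8] using h⟩
  · exact ⟨3, by simpa only [Nat.reduceAdd, e5, e6, e7, e8] using h⟩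
  · exact ⟨4, by simpa only [Nat.reduceAdd, e5, e6, e7, e8] using h⟩

/-- The values `a` for which there are orbits of size five with top entries
`1, a, n - a, a + 1, n - 1 - a`. -/
def fiveParam (n : ℕ) : Finset ℕ :=
  {a ∈ Finset.Icc 2 (n - 3) | 2 * a ≠ n ∧ 2 * a + 1 ≠ n ∧ 2 * a + 2 ≠ n}

/-- The prescribed entries of the deck with top entry `1` in such an orbit. -/
def fiveDeck (n a : ℕ) : List (ℕ × ℕ) :=
  [(0, 1), (1, a), (a, a + 1), (a + 1, n - a), (n - 1, n - 1 - a)]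

lemma card_fiveParam {n : ℕ} (hn : 7 ≤ n) :
    (fiveParam n).card = if Even n then n - 6 else n - 5 := by
  split_ifs with h
  · obtain ⟨m, hm⟩ := h
    have : fiveParam n = ((Finset.Icc 2 (n - 3)).erase m).erase (m - 1) := by
      ext a
      simp only [fiveParam, Finset.mem_filter, Finset.mem_Icc, Finset.mem_erase]
      omega
    rw [this, Finset.card_erase_of_mem, Finset.card_erase_of_mem, Nat.card_Icc]
    · omega
    · simp; omega
    · simp; omega
  · obtain ⟨m, hm⟩ := Nat.not_even_iff_odd.1 h
    have : fiveParam n = (Finset.Icc 2 (n - 3)).erase m := by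
      ext a
      simp only [fiveParam, Finset.mem_filter, Finset.mem_Icc, Finset.mem_erase]
      omega
    rw [this, Finset.card_erase_of_mem, Nat.card_Icc]
    · omega
    · simp; omega

lemma forall_fiveDeck_iff {n a : ℕ} {π : Equiv.Perm (Fin n)} (h1 : 2 ≤ a) (h2 : a + 3 ≤ n) :
    (∀ q ∈ fiveDeck n a, entry π q.1 = q.2) ↔ topEntry π 0 = 1 ∧ topEntry π 1 = a ∧
      topEntry π 2 = n - a ∧ topEntry π 3 = a + 1 ∧ topEntry π 4 = n - 1 - a := by
  simp only [fiveDeck, List.forall_mem_cons, List.not_mem_nil, false_implies, implies_true,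
    and_true]
  refine and_congr_right fun h0 => ?_
  change entry π 0 = 1 at h0
  have ht (i : ℕ) (hi : i + 1 < n) : entry (topdrop π) i = entry π (i + 1) := by
    rw [entry_topdrop _ (by omega), h0, if_pos hi]
  rw [show topEntry π 1 = entry π 1 by rw [topEntry_one_of_lt (by omega), h0]]
  by_cases e1 : entry π 1 = a
  swap
  · simp [e1]
  have k1 : topEntry π 1 = a := by rw [topEntry_one_of_lt (by omega), h0, e1]
  have k2 : topEntry π 2 = entry π (a + 1) := by
    rw [topEntry_two_of_lt (by omega), k1, h0, if_pos (by omega)]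
  rw [k2]
  by_cases e2 : entry π (a + 1) = n - a
  swap
  · simp [e2]
  have k3 : topEntry π 3 = entry π a := by
    rw [topEntry_three_of_lt (by omega), k2, e2, k1, if_neg (by omega), ht _ (by omega)]
    congr 1
    omega
  rw [k3]
  by_cases e3 : entry π a = a + 1
  swap
  · simp [e3]
  have k4 : topEntry π 4 = entry π (n - 1) := by
    have k1' : topEntry (topdrop π) 0 = a := k1
    have k2' : topEntry (topdrop π) 1 = n - a := k2.trans e2
    have k3' : topEntry (topdrop π) 2 = a + 1 := k3.trans e3
    rw [topEntry_succ, topEntry_three_of_lt (by omega), k2', k3', if_neg (by omega),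
      entry_topdrop _ (by omega), show entry (topdrop π) 0 = a from k1', if_pos (by omega),
      ht _ (by omega)]
    congr 1
    omega
  rw [k4]
  tauto

/-- These five drops return every position to itself, so the other `n - 5` cards are arbitrary. -/
lemma iterate_five_of_topEntry {n a : ℕ} {π : Equiv.Perm (Fin n)} (h1 : 2 ≤ a) (h2 : a + 3 ≤ n)
    (k0 : topEntry π 0 = 1) (k1 : topEntry π 1 = a) (k2 : topEntry π 2 = n - a)
    (k3 : topEntry π 3 = a + 1) (k4 : topEntry π 4 = n - 1 - a) : topdrop^[5] π = π := by
  apply perm_ext_entry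
  intro x hx
  have h : trackPos n (topEntry π) x 5 = x := by
    change dropPos n (topEntry π 4) (dropPos n (topEntry π 3) (dropPos n (topEntry π 2)
      (dropPos n (topEntry π 1) (dropPos n (topEntry π 0) x)))) = x
    rw [k0, k1, k2, k3, k4]
    unfold dropPos
    split_ifs <;> omega
  rw [← entry_iterate_trackPos π hx 5, h]

lemma numOrbits_five {n : ℕ} (hn : 7 ≤ n) :
    numOrbits n 5 = (if Even n then n - 6 else n - 5) * (n - 5)! := by
  have hS {a : ℕ} (ha : a ∈ fiveParam n) :
      2 ≤ a ∧ a + 3 ≤ n ∧ 2 * a ≠ n ∧ 2 * a + 1 ≠ n ∧ 2 * a + 2 ≠ n := by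
    simp only [fiveParam, Finset.mem_filter, Finset.mem_Icc] at ha
    omega
  have hc := card_decksWith (n := n) (S := fiveParam n) (L := fiveDeck n)
    (by intro a ha; have := hS ha; simp [fiveDeck]; omega)
    (by intro a ha; have := hS ha; simp [fiveDeck]; omega)
    (by intro a ha; have := hS ha; simp [fiveDeck]; omega)
    (by intro a ha b hb π h h'; simp [fiveDeck] at h h'; omega)
  rw [Finset.sum_congr rfl (g := fun _ => (n - 5)!) (by simp [fiveDeck]), Finset.sum_const,
    smul_eq_mul, card_fiveParam hn] at hc
  rw [← hc]
  have hmem {π : Equiv.Perm (Fin n)} : π ∈ decksWith n (fiveParam n) (fiveDeck n) ↔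
      ∃ a ∈ fiveParam n, topEntry π 0 = 1 ∧ topEntry π 1 = a ∧
      topEntry π 2 = n - a ∧ topEntry π 3 = a + 1 ∧ topEntry π 4 = n - 1 - a := by
    rw [mem_decksWith]
    refine exists_congr fun a => and_congr_right fun ha => ?_
    have := hS ha
    exact forall_fiveDeck_iff this.1 this.2.1
  apply numOrbits_eq_card
  · intro π hπ
    obtain ⟨a, ha, k0, k1, k2, k3, k4⟩ := hmem.1 hπ
    have := hS ha
    have : Fact (Nat.Prime 5) := ⟨Nat.prime_five⟩
    exact minimalPeriod_eq_prime
      (iterate_five_of_topEntry (by omega) (by omega) k0 k1 k2 k3 k4)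
      (iterate_one_ne (by omega) π)
  · intro π h
    have h5 := minimalPeriod_eq_of h
    obtain ⟨i, h1, h2, h3⟩ := topEntry_of_iterate_five (by omega) h5
    refine ⟨i, ?_⟩
    have hσ : topdrop^[5] (topdrop^[i] π) = topdrop^[i] π := by
      rw [← iterate_add_apply, Nat.add_comm, iterate_add_apply, h5]
    have e (t : ℕ) : topEntry (topdrop^[i] π) t = topEntry π (t + i) := topEntry_iterate π i t
    have e0 := e 0
    rw [Nat.zero_add] at e0
    simp only [← e, ← e0] at h1 h2 h3
    clear e e0 h h5
    generalize topdrop^[i] π = σ at *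
    have hlt := topEntry_lt_of_iterate_five (by omega) hσ
    have hpos := topEntry_pos (by omega) σ
    have k0 : topEntry σ 0 = 1 := by
      -- If the top entry exceeded `1`, the card at position `1` would visit `n - 2`, `n - 2 - k₁`,
      -- `k₁ + 1`, `k₄ - 1` and end at `k₁ + 1 ≠ 1`, where `kᵢ` is the top entry after `i` drops.
      by_contra hne
      have h : trackPos n (topEntry σ) 1 5 = 1 :=
        trackPos_eq (by omega) (by omega) (by rw [hσ])
      change dropPos n (topEntry σ 4) (dropPos n (topEntry σ 3) (dropPos n (topEntry σ 2)
        (dropPos n (topEntry σ 1) (dropPos n (topEntry σ 0) 1)))) = 1 at h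
      have := hpos 0
      have := hpos 1
      have := hpos 4
      have := hlt 1
      have := hlt 4
      have hd (k x y : ℕ) (hxy : x < k ∧ y + x + 1 = n) : dropPos n k x = y := by
        rw [dropPos, if_pos hxy.1]
        omega
      rw [hd _ 1 (n - 2) (by omega), dropPos.eq_def n (topEntry σ 1), if_neg (by omega),
        hd _ (n - 2 - topEntry σ 1) (topEntry σ 1 + 1) (by omega),
        hd _ (topEntry σ 1 + 1) (topEntry σ 4 - 1) (by omega),
        hd _ (topEntry σ 4 - 1) (topEntry σ 1 + 1) (by omega)] at h
      omega
    have n1 : topEntry σ 2 ≠ topEntry σ 1 := topEntry_one_ne (by omega) σ 1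
    have n2 : topEntry σ 3 ≠ topEntry σ 2 := topEntry_one_ne (by omega) σ 2
    have n3 : topEntry σ 4 ≠ topEntry σ 3 := topEntry_one_ne (by omega) σ 3
    have n4 : topEntry σ 5 ≠ topEntry σ 4 := topEntry_one_ne (by omega) σ 4
    have n5 : topEntry σ 1 ≠ topEntry σ 0 := topEntry_one_ne (by omega) σ 0
    have n6 : topEntry σ 6 ≠ topEntry σ 4 := topEntry_two_ne (i := 4) (hlt 5)
    have e5 : topEntry σ 5 = topEntry σ 0 := topEntry_add_period hσ 0
    have e6 : topEntry σ 6 = topEntry σ 1 := topEntry_add_period hσ 1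
    have := hpos 1
    have := hpos 4
    have := hlt 1
    have := hlt 4
    refine hmem.2 ⟨topEntry σ 1, ?_, k0, rfl, by omega, by omega, by omega⟩
    simp only [fiveParam, Finset.mem_filter, Finset.mem_Icc]
    omega
  · intro π hπ i hi hi'
    obtain ⟨a, ha, k0, k1, k2, k3, k4⟩ := hmem.1 hπ
    obtain ⟨-, -, k0', -⟩ := hmem.1 hi'
    rw [topEntry_iterate, Nat.zero_add] at k0'
    have := hS ha
    interval_cases i <;> omega

/-! ### Lower bounds from symmetric decks -/

lemma sum_le_numOrbits {ι : Type*} {n m : ℕ} (hn : 1 ≤ n) {S : Finset ι}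
    (L : ℕ × ι → List (ℕ × ℕ)) (l : ι → ℕ) (hl : ∀ i ∈ S, ∀ y, (L (y, i)).length = l i)
    (h1 : ∀ i ∈ S, ∀ y, ((L (y, i)).map Prod.fst).Nodup)
    (h2 : ∀ i ∈ S, ∀ y, n - 1 ≤ y → y ≤ n → ((L (y, i)).map Prod.snd).Nodup)
    (h3 : ∀ i ∈ S, ∀ y, n - 1 ≤ y → y ≤ n → ∀ q ∈ L (y, i), q.1 < n ∧ 1 ≤ q.2 ∧ q.2 ≤ n)
    (h4 : ∀ i ∈ S, ∀ j ∈ S, ∀ y z, ∀ π : Equiv.Perm (Fin n),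
      (∀ q ∈ L (y, i), entry π q.1 = q.2) → (∀ q ∈ L (z, j), entry π q.1 = q.2) → y = z ∧ i = j)
    (hX : ∀ i ∈ S, ∀ y, n - 1 ≤ y → y ≤ n → ∀ π : Equiv.Perm (Fin n),
      (∀ q ∈ L (y, i), entry π q.1 = q.2) →
        n - 1 ≤ entry π 0 ∧ minimalPeriod topdrop π = 2 * m) :
    ∑ i ∈ S, (n - l i)! ≤ numOrbits n (2 * m) := by
  have hy {p : ℕ × ι} (hp : p ∈ ({n - 1, n} : Finset ℕ) ×ˢ S) :
      n - 1 ≤ p.1 ∧ p.1 ≤ n ∧ p.2 ∈ S := by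
    simp only [Finset.mem_product, Finset.mem_insert, Finset.mem_singleton] at hp
    exact ⟨by omega, by omega, hp.2⟩
  have hc := card_decksWith (n := n) (S := ({n - 1, n} : Finset ℕ) ×ˢ S) (L := L)
    (fun p hp => h1 _ (hy hp).2.2 _)
    (fun p hp => h2 _ (hy hp).2.2 _ (hy hp).1 (hy hp).2.1)
    (fun p hp => h3 _ (hy hp).2.2 _ (hy hp).1 (hy hp).2.1)
    (fun p hp q hq π h h' => Prod.ext_iff.2 (h4 _ (hy hp).2.2 _ (hy hq).2.2 _ _ π h h'))
  have hle := card_le_two_mul_numOrbits (m := m)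
    (decksWith n (({n - 1, n} : Finset ℕ) ×ˢ S) L)
    (fun π hπ => by
      obtain ⟨p, hp, h⟩ := mem_decksWith.1 hπ
      exact (hX _ (hy hp).2.2 _ (hy hp).1 (hy hp).2.1 π h).2)
    (fun π hπ => by
      obtain ⟨p, hp, h⟩ := mem_decksWith.1 hπ
      exact (hX _ (hy hp).2.2 _ (hy hp).1 (hy hp).2.1 π h).1)
  have hs (y : ℕ) : ∑ i ∈ S, (n - (L (y, i)).length)! = ∑ i ∈ S, (n - l i)! :=
    Finset.sum_congr rfl fun i hi => by rw [hl i hi]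
  rw [hc, Finset.sum_product, Finset.sum_pair (by omega), hs, hs] at hle
  omega

/-- The position in the reversal of a deck at which the card at position `x` is found after the
top `a` cards of the deck are dropped. -/
def revDropPos (n a x : ℕ) : ℕ := if x + a < n then n - 1 - (x + a) else x

lemma entry_iterate_two {n : ℕ} {π : Equiv.Perm (Fin n)} {x : ℕ} (hX : n - 1 ≤ entry π 0)
    (hx : x < n) : entry (topdrop^[2] π) x = entry π (revDropPos n (topEntry π 1) x) := by
  have h := entry_topdrop (topdrop π) hx
  change _ = if x + topEntry π 1 < n then entry _ (x + topEntry π 1) else _ at h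
  change entry (topdrop (topdrop π)) x = _
  rw [h, topdrop_eq_revDeck hX, revDropPos]
  split_ifs with h1
  · exact entry_revDeck _ h1
  · rw [entry_revDeck _ (by omega)]
    congr 1
    omega

lemma topEntry_two_of_le {n : ℕ} {π : Equiv.Perm (Fin n)} (hX : n - 1 ≤ entry π 0)
    (h1 : topEntry π 1 < n) : topEntry π 2 = entry π (n - 1 - topEntry π 1) := by
  rw [topEntry, entry_iterate_two hX (by omega), revDropPos, Nat.zero_add, if_pos h1]

lemma topEntry_three_of_le {n : ℕ} {π : Equiv.Perm (Fin n)} (hX : n - 1 ≤ entry π 0)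
    (h2 : topEntry π 2 < n) :
    topEntry π 3 = entry π (revDropPos n (topEntry π 1) (topEntry π 2)) := by
  rw [← entry_iterate_two hX h2]
  exact topEntry_one_of_lt (π := topdrop^[2] π) h2

lemma topEntry_four_of_le {n : ℕ} {π : Equiv.Perm (Fin n)} (hX : n - 1 ≤ entry π 0)
    (h3 : topEntry π 3 < n) :
    topEntry π 4 = entry π (revDropPos n (topEntry π 1)
      (if topEntry π 3 + topEntry π 2 < n then topEntry π 3 + topEntry π 2
        else n - 1 - topEntry π 3)) := by
  rw [← entry_iterate_two hX (by split_ifs <;> omega)]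
  refine (topEntry_two_of_lt (π := topdrop^[2] π) h3).trans ?_
  exact (apply_ite _ _ _ _).symm

/-! ### Orbits of size six -/

/-- The prescribed entries of a deck with successive top entries `y, a, b, x`, where `x` and `y`
are `n - 1` or `n`. -/
def sixDeck (n : ℕ) (p : ℕ × ℕ × ℕ) : List (ℕ × ℕ) :=
  [(0, p.1), (n - 1, p.2.1), (n - 1 - p.2.1, p.2.2)] ++
    if p.2.1 + p.2.2 = n - 1 then []
    else [(revDropPos n p.2.1 p.2.2, 2 * n - 1 - p.1)]

lemma minimalPeriod_of_sixDeck {n y a b : ℕ} {π : Equiv.Perm (Fin n)} (hy : n - 1 ≤ y)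
    (hy' : y ≤ n) (ha : 1 ≤ a) (ha' : a ≤ n - 2) (hb : 1 ≤ b) (hb' : b ≤ n - 2)
    (h : ∀ q ∈ sixDeck n (y, a, b), entry π q.1 = q.2) :
    n - 1 ≤ entry π 0 ∧ minimalPeriod topdrop π = 2 * 3 := by
  simp only [sixDeck, List.mem_append, List.mem_cons, List.not_mem_nil, or_false, or_imp,
    forall_and, forall_eq] at h
  obtain ⟨⟨h0, h1, h2⟩, h3⟩ := h
  have hX : n - 1 ≤ entry π 0 := by omega
  have k1 : topEntry π 1 = a := by rw [topEntry_one_of_le (by omega) hX, h1]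
  have k2 : topEntry π 2 = b := by rw [topEntry_two_of_le hX (by omega), k1, h2]
  have k3 : n - 1 ≤ topEntry π 3 := by
    rw [topEntry_three_of_le hX (by omega), k1, k2]
    -- If `a + b = n - 1`, the next top card comes from position `0`, so it is `y` again and needs
    -- no prescription. Otherwise it is prescribed as the other of `n - 1` and `n`.
    split_ifs at h3 with hab
    · rw [revDropPos, if_pos (by omega), show n - 1 - (b + a) = 0 by omega]
      exact hX
    · simp only [List.mem_singleton, forall_eq] at h3
      omega
  refine ⟨hX, ?_⟩
  have hd : minimalPeriod topdrop π ∣ 6 :=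
    IsPeriodicPt.minimalPeriod_dvd (iterate_two_mul_eq_self (i := 3) hX k3)
  have hle := Nat.le_of_dvd (by norm_num) hd
  have hper : topdrop^[minimalPeriod topdrop π] π = π := iterate_minimalPeriod
  generalize minimalPeriod topdrop π = d at *
  interval_cases d
  · omega
  · exact absurd hper (iterate_one_ne (by omega) π)
  · have : topEntry π 2 = topEntry π 0 := topEntry_add_period hper 0
    have : topEntry π 0 = y := h0
    omega
  · exact absurd hper (iterate_three_ne (by omega) π)
  · omega
  · omega
  · rfl

lemma card_filter_add_eq (n : ℕ) :
    ({p ∈ (Finset.Icc 1 (n - 2)).offDiag | p.1 + p.2 = n - 1} : Finset (ℕ × ℕ)).card =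
      if Even n then n - 2 else n - 3 := by
  have h : ({p ∈ (Finset.Icc 1 (n - 2)).offDiag | p.1 + p.2 = n - 1} : Finset (ℕ × ℕ)) =
      ({a ∈ Finset.Icc 1 (n - 2) | 2 * a ≠ n - 1}).image fun a => (a, n - 1 - a) := by
    ext ⟨a, b⟩
    simp only [Finset.mem_filter, Finset.mem_offDiag, Finset.mem_Icc, Finset.mem_image,
      Prod.mk.injEq]
    constructor
    · rintro h
      exact ⟨a, by omega, rfl, by omega⟩
    · rintro ⟨c, h, rfl, rfl⟩
      omega
  rw [h, Finset.card_image_of_injective _ fun a b hab => (Prod.mk.inj hab).1]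
  split_ifs with he
  · obtain ⟨m, hm⟩ := he
    rw [Finset.filter_true_of_mem, Nat.card_Icc]
    · omega
    · intro a ha
      rw [Finset.mem_Icc] at ha
      omega
  · obtain ⟨m, hm⟩ := Nat.not_even_iff_odd.1 he
    have : ({a ∈ Finset.Icc 1 (n - 2) | 2 * a ≠ n - 1} : Finset ℕ) =
        (Finset.Icc 1 (n - 2)).erase m := by
      ext a
      simp only [Finset.mem_filter, Finset.mem_Icc, Finset.mem_erase]
      omega
    rw [this]
    rcases Nat.eq_zero_or_pos m with rfl | hm'
    · simp [hm]
    · rw [Finset.card_erase_of_mem (by simp; omega), Nat.card_Icc]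
      omega

lemma le_numOrbits_six {n : ℕ} (hn : 4 ≤ n) :
    ((n - 2) * (n - 3) + (n - 4) * if Even n then n - 2 else n - 3) * (n - 4)! ≤
      numOrbits n 6 := by
  have hle := sum_le_numOrbits (m := 3) (n := n) (by omega)
    (S := (Finset.Icc 1 (n - 2)).offDiag) (sixDeck n)
    (fun p => if p.1 + p.2 = n - 1 then 3 else 4)
    (by
      rintro ⟨a, b⟩ - y
      simp only [sixDeck]
      split_ifs <;> rfl)
    (by
      rintro ⟨a, b⟩ h y
      simp only [Finset.mem_offDiag, Finset.mem_Icc] at h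
      simp only [sixDeck, revDropPos]
      split_ifs <;> simp <;> omega)
    (by
      rintro ⟨a, b⟩ h y hy hy'
      simp only [Finset.mem_offDiag, Finset.mem_Icc] at h
      simp only [sixDeck]
      split_ifs <;> simp <;> omega)
    (by
      rintro ⟨a, b⟩ h y hy hy'
      simp only [Finset.mem_offDiag, Finset.mem_Icc] at h
      simp only [sixDeck, revDropPos]
      split_ifs <;> simp <;> omega)
    (by
      rintro ⟨a, b⟩ - ⟨a', b'⟩ - y z π h h'
      simp only [sixDeck, List.mem_append, or_imp, forall_and, List.forall_mem_cons] at h h'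
      obtain ⟨⟨h0, h1, h2, -⟩, -⟩ := h
      obtain ⟨⟨h0', h1', h2', -⟩, -⟩ := h'
      obtain rfl : a = a' := h1.symm.trans h1'
      exact ⟨h0.symm.trans h0', Prod.ext rfl (h2.symm.trans h2')⟩)
    (by
      rintro ⟨a, b⟩ h y hy hy' π hπ
      simp only [Finset.mem_offDiag, Finset.mem_Icc] at h
      exact minimalPeriod_of_sixDeck hy hy' h.1.1 h.1.2 h.2.1.1 h.2.1.2 hπ)
  refine le_of_eq_of_le ?_ hle
  have h3 : (n - 3)! = (n - 4) * (n - 4)! + (n - 4)! := by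
    rw [show n - 3 = n - 4 + 1 by omega, Nat.factorial_succ]
    ring
  -- Every pair contributes `(n - 4)!`; a pair with sum `n - 1` has one prescribed entry fewer and
  -- contributes the excess over `(n - 4)!` as well.
  have hw (p : ℕ × ℕ) : (n - if p.1 + p.2 = n - 1 then 3 else 4)! =
      (if p.1 + p.2 = n - 1 then (n - 4) * (n - 4)! else 0) + (n - 4)! := by
    split_ifs
    · exact h3
    · exact (Nat.zero_add _).symm
  simp only [hw]
  rw [Finset.sum_add_distrib, ← Finset.sum_filter, Finset.sum_const, Finset.sum_const,
    card_filter_add_eq, Finset.offDiag_card, Nat.card_Icc, smul_eq_mul, smul_eq_mul,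
    show n - 2 + 1 - 1 = n - 2 by omega, ← Nat.mul_sub_one, show n - 2 - 1 = n - 3 by omega]
  ring

/-! ### Orbits of size eight -/

/-- The pairs of a value `b` and a pair `(a, c)` such that `a, b, c` are the successive top entries
between two points of symmetry in an orbit of size eight. -/
def eightParam (n : ℕ) : Finset (Σ _ : ℕ, ℕ × ℕ) :=
  (Finset.Icc 1 (n - 2)).sigma fun b =>
    ({a ∈ Finset.Icc 1 (n - 2) | a ≠ b ∧ a + b ≠ n - 1} : Finset ℕ).offDiag

lemma mem_eightParam {n a b c : ℕ} : (⟨b, (a, c)⟩ : Σ _ : ℕ, ℕ × ℕ) ∈ eightParam n ↔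
    (1 ≤ a ∧ a ≤ n - 2) ∧ (1 ≤ b ∧ b ≤ n - 2) ∧ (1 ≤ c ∧ c ≤ n - 2) ∧ a ≠ b ∧ c ≠ b ∧ a ≠ c ∧
      a + b ≠ n - 1 ∧ c + b ≠ n - 1 := by
  simp only [eightParam, Finset.mem_sigma, Finset.mem_offDiag, Finset.mem_filter, Finset.mem_Icc]
  tauto

/-- The prescribed entries of a deck with successive top entries `y, a, b, c, x`, where `x` and `y`
are `n - 1` or `n`. -/
def eightDeck (n : ℕ) (p : ℕ × Σ _ : ℕ, ℕ × ℕ) : List (ℕ × ℕ) :=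
  [(0, p.1), (n - 1, p.2.2.1), (n - 1 - p.2.2.1, p.2.1),
    (revDropPos n p.2.2.1 p.2.1, p.2.2.2)] ++
    if p.2.2.1 + p.2.1 + p.2.2.2 = n - 1 then []
    else [(revDropPos n p.2.2.1
      (if p.2.2.2 + p.2.1 < n then p.2.2.2 + p.2.1 else n - 1 - p.2.2.2), 2 * n - 1 - p.1)]

lemma minimalPeriod_of_eightDeck {n y a b c : ℕ} {π : Equiv.Perm (Fin n)} (hy : n - 1 ≤ y)
    (hy' : y ≤ n) (hp : (⟨b, (a, c)⟩ : Σ _ : ℕ, ℕ × ℕ) ∈ eightParam n)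
    (h : ∀ q ∈ eightDeck n (y, ⟨b, (a, c)⟩), entry π q.1 = q.2) :
    n - 1 ≤ entry π 0 ∧ minimalPeriod topdrop π = 2 * 4 := by
  rw [mem_eightParam] at hp
  simp only [eightDeck, List.mem_append, List.mem_cons, List.not_mem_nil, or_false, or_imp,
    forall_and, forall_eq] at h
  obtain ⟨⟨h0, h1, h2, h3⟩, h4⟩ := h
  have hX : n - 1 ≤ entry π 0 := by omega
  have k1 : topEntry π 1 = a := by rw [topEntry_one_of_le (by omega) hX, h1]
  have k2 : topEntry π 2 = b := by rw [topEntry_two_of_le hX (by omega), k1, h2]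
  have k3 : topEntry π 3 = c := by rw [topEntry_three_of_le hX (by omega), k1, k2, h3]
  have k4 : n - 1 ≤ topEntry π 4 := by
    rw [topEntry_four_of_le hX (by omega), k1, k2, k3]
    by_cases habc : a + b + c = n - 1
    · rw [if_pos (by omega), revDropPos, if_pos (by omega),
        show n - 1 - (c + b + a) = 0 by omega]
      exact hX
    · simp only [if_neg habc, List.mem_singleton, forall_eq] at h4
      rw [h4]
      omega
  refine ⟨hX, minimalPeriod_eq_prime_pow (p := 2) (k := 2) (fun h => ?_)
    (iterate_two_mul_eq_self (i := 4) hX k4)⟩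
  -- A period dividing four would, by reflection, give `c = a`.
  have : topEntry π 3 = topEntry π 1 := topEntry_sub hX (s := 4) (j := 1) h (by omega)
  omega

/-- For fixed `b`, both `a` and `c` avoid `b` and `n - 1 - b`. These coincide only when `2 * b = n -
1`, which leaves one more candidate and hence `2 * (n - 4)` more ordered pairs. -/
lemma card_eightParam {n : ℕ} (hn : 5 ≤ n) : (eightParam n).card =
    (n - 2) * ((n - 4) * (n - 5)) + if Even n then 0 else 2 * (n - 4) := by
  have hF {b : ℕ} (hb : b ∈ Finset.Icc 1 (n - 2)) :
      ({a ∈ Finset.Icc 1 (n - 2) | a ≠ b ∧ a + b ≠ n - 1} : Finset ℕ).offDiag.card =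
        (n - 4) * (n - 5) + if 2 * b = n - 1 then 2 * (n - 4) else 0 := by
    rw [Finset.mem_Icc] at hb
    obtain ⟨m, rfl⟩ := Nat.exists_eq_add_of_le' hn
    have he : ({a ∈ Finset.Icc 1 (m + 5 - 2) | a ≠ b ∧ a + b ≠ m + 5 - 1} : Finset ℕ) =
        ((Finset.Icc 1 (m + 5 - 2)).erase b).erase (m + 5 - 1 - b) := by
      ext a
      simp only [Finset.mem_filter, Finset.mem_Icc, Finset.mem_erase]
      omega
    rw [Finset.offDiag_card, he, Finset.card_erase_eq_ite, Finset.card_erase_of_mem (by simp; omega),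
      Nat.card_Icc]
    simp only [Finset.mem_erase, Finset.mem_Icc]
    by_cases h2 : 2 * b = m + 5 - 1
    · rw [if_neg (by omega), if_pos h2, show m + 5 - 2 + 1 - 1 - 1 = m + 2 by omega,
        show m + 5 - 4 = m + 1 by omega, Nat.add_sub_cancel, ← Nat.mul_sub_one]
      simp only [Nat.reduceSubDiff]
      ring
    · rw [if_pos (by omega), if_neg h2, show m + 5 - 2 + 1 - 1 - 1 - 1 = m + 1 by omega,
        show m + 5 - 4 = m + 1 by omega, Nat.add_sub_cancel, ← Nat.mul_sub_one]
      rfl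
  rw [eightParam, Finset.card_sigma, Finset.sum_congr rfl fun b hb => hF hb,
    Finset.sum_add_distrib, Finset.sum_const, Nat.card_Icc, smul_eq_mul,
    show n - 2 + 1 - 1 = n - 2 by omega]
  congr 1
  split_ifs with he
  · obtain ⟨m, hm⟩ := he
    exact Finset.sum_eq_zero fun b _ => if_neg (by omega)
  · obtain ⟨m, hm⟩ := Nat.not_even_iff_odd.1 he
    rw [Finset.sum_eq_single m, if_pos (by omega)]
    · intro b _ hb
      exact if_neg (by omega)
    · intro h
      rw [Finset.mem_Icc] at h
      omega

/-- The compositions of `N` into three parts, recorded by the sum of the first two parts and the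
first part. -/
def threeParts (N : ℕ) : Finset (Σ _ : ℕ, ℕ) := (Finset.range N).sigma fun t => Finset.Ico 1 t

lemma two_mul_card_threeParts (N : ℕ) : 2 * (threeParts N).card = (N - 1) * (N - 2) := by
  rw [threeParts, Finset.card_sigma]
  simp only [Nat.card_Ico]
  cases N with
  | zero => rfl
  | succ m =>
    rw [Finset.sum_range_succ', Nat.zero_sub, Nat.add_zero, Nat.mul_comm]
    exact Finset.sum_range_id_mul_two m

/-- Each of the three possible equalities between parts has at most `(N - 1) / 2` solutions. When
`N` is a positive multiple of three, the composition with all parts equal is common to all three, so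
`G` drops it from two of them, saving two; `N = 0` is compensated separately. -/
lemma card_threeParts_not_distinct_le (N : ℕ) :
    ({p ∈ threeParts N | ¬(2 * p.2 ≠ p.1 ∧ p.1 + p.2 ≠ N ∧ 2 * p.1 ≠ N + p.2)}).card +
      2 * (if N % 3 = 0 then 1 else 0) ≤ 3 * ((N - 1) / 2) + if N = 0 then 2 else 0 := by
  let G := {x ∈ Finset.Icc 1 ((N - 1) / 2) | 3 * x ≠ N}
  have hG : G.card + (if N % 3 = 0 then 1 else 0) ≤ (N - 1) / 2 + if N = 0 then 1 else 0 := by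
    have hG' : G.card ≤ (N - 1) / 2 :=
      (Finset.card_filter_le _ _).trans (by rw [Nat.card_Icc, Nat.add_sub_cancel])
    split_ifs with h h0 h0
    · simp [G, h0]
    · obtain ⟨q, hq⟩ := Nat.dvd_of_mod_eq_zero h
      have : G = (Finset.Icc 1 ((N - 1) / 2)).erase q := by
        ext x
        simp only [G, Finset.mem_filter, Finset.mem_Icc, Finset.mem_erase]
        omega
      rw [this, Finset.card_erase_add_one (by simp; omega), Nat.card_Icc]
      omega
    · omega
    · omega
  have hsub : ({p ∈ threeParts N | ¬(2 * p.2 ≠ p.1 ∧ p.1 + p.2 ≠ N ∧ 2 * p.1 ≠ N + p.2)}) ⊆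
      (Finset.Icc 1 ((N - 1) / 2)).image (fun x => (⟨2 * x, x⟩ : Σ _ : ℕ, ℕ)) ∪
        (G.image (fun x => (⟨N - x, x⟩ : Σ _ : ℕ, ℕ)) ∪
          G.image (fun x => (⟨N - x, N - 2 * x⟩ : Σ _ : ℕ, ℕ))) := by
    rintro ⟨t, a⟩ h
    simp only [threeParts, Finset.mem_filter, Finset.mem_sigma, Finset.mem_range,
      Finset.mem_Ico] at h
    simp only [G, Finset.mem_union, Finset.mem_image, Finset.mem_filter, Finset.mem_Icc,
      Sigma.mk.injEq, heq_eq_eq]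
    by_cases h1 : 2 * a = t
    · exact Or.inl ⟨a, by omega, h1, rfl⟩
    by_cases h2 : t + a = N
    · exact Or.inr (Or.inl ⟨a, by omega, by omega, rfl⟩)
    · exact Or.inr (Or.inr ⟨N - t, by omega, by omega, by omega⟩)
  have h := Finset.card_le_card hsub
  have h1 := Finset.card_union_le ((Finset.Icc 1 ((N - 1) / 2)).image
    (fun x => (⟨2 * x, x⟩ : Σ _ : ℕ, ℕ))) (G.image (fun x => (⟨N - x, x⟩ : Σ _ : ℕ, ℕ)) ∪
          G.image (fun x => (⟨N - x, N - 2 * x⟩ : Σ _ : ℕ, ℕ)))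
  have h2 := Finset.card_union_le (G.image (fun x => (⟨N - x, x⟩ : Σ _ : ℕ, ℕ)))
    (G.image (fun x => (⟨N - x, N - 2 * x⟩ : Σ _ : ℕ, ℕ)))
  have h3 : ((Finset.Icc 1 ((N - 1) / 2)).image (fun x => (⟨2 * x, x⟩ : Σ _ : ℕ, ℕ))).card ≤
      (N - 1) / 2 := Finset.card_image_le.trans (by simp)
  have h4 : (G.image (fun x => (⟨N - x, x⟩ : Σ _ : ℕ, ℕ))).card ≤ G.card := Finset.card_image_le
  have h5 : (G.image (fun x => (⟨N - x, N - 2 * x⟩ : Σ _ : ℕ, ℕ))).card ≤ G.card :=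
    Finset.card_image_le
  split_ifs at hG ⊢ <;> omega

/-- Compositions of `n - 1` into distinct parts `a, b, c` satisfy the remaining conditions of
`eightParam` automatically, since the third part is positive. -/
lemma card_filter_eightParam {n : ℕ} (hn : 2 ≤ n) :
    (n - 2) * (n - 3) + 4 * (if n % 3 = 1 then 1 else 0) ≤
      2 * ({p ∈ eightParam n | p.2.1 + p.1 + p.2.2 = n - 1}).card + 6 * ((n - 2) / 2) := by
  have h1 := two_mul_card_threeParts (n - 1)
  have h2 := card_threeParts_not_distinct_le (n - 1)
  have h3 := Finset.card_filter_add_card_filter_not (s := threeParts (n - 1))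
    fun p => 2 * p.2 ≠ p.1 ∧ p.1 + p.2 ≠ n - 1 ∧ 2 * p.1 ≠ n - 1 + p.2
  have h4 : ({p ∈ threeParts (n - 1) |
      2 * p.2 ≠ p.1 ∧ p.1 + p.2 ≠ n - 1 ∧ 2 * p.1 ≠ n - 1 + p.2}).card ≤
        ({p ∈ eightParam n | p.2.1 + p.1 + p.2.2 = n - 1}).card := by
    apply Finset.card_le_card_of_injOn
      fun p => (⟨p.1 - p.2, (p.2, n - 1 - p.1)⟩ : Σ _ : ℕ, ℕ × ℕ)
    · rintro ⟨t, a⟩ h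
      simp only [threeParts, Finset.coe_filter, Finset.mem_sigma, Finset.mem_range,
        Finset.mem_Ico, Set.mem_ofPred_eq] at h
      simp only [Finset.coe_filter, mem_eightParam, Set.mem_ofPred_eq]
      omega
    · rintro ⟨t, a⟩ h ⟨t', a'⟩ h' hh
      simp only [threeParts, Finset.coe_filter, Finset.mem_sigma, Finset.mem_range,
        Finset.mem_Ico, Set.mem_ofPred_eq] at h h'
      simp only [Sigma.mk.injEq, heq_eq_eq, Prod.mk.injEq] at hh ⊢
      omega
  rw [show n - 1 - 1 = n - 2 by omega, show n - 1 - 2 = n - 3 by omega] at h1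
  rw [show n - 1 - 1 = n - 2 by omega] at h2
  split_ifs at h2 ⊢ <;> omega

lemma le_numOrbits_eight {n : ℕ} (hn : 5 ≤ n) :
    ((eightParam n).card +
      (n - 5) * ({p ∈ eightParam n | p.2.1 + p.1 + p.2.2 = n - 1}).card) * (n - 5)! ≤
        numOrbits n 8 := by
  have hle := sum_le_numOrbits (m := 4) (n := n) (by omega) (S := eightParam n) (eightDeck n)
    (fun p => if p.2.1 + p.1 + p.2.2 = n - 1 then 4 else 5)
    (by
      rintro ⟨b, a, c⟩ - y
      simp only [eightDeck]
      split_ifs <;> rfl)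
    (by
      rintro ⟨b, a, c⟩ h y
      rw [mem_eightParam] at h
      simp only [eightDeck, revDropPos]
      split_ifs <;> simp <;> omega)
    (by
      rintro ⟨b, a, c⟩ h y hy hy'
      rw [mem_eightParam] at h
      simp only [eightDeck]
      split_ifs <;> simp <;> omega)
    (by
      rintro ⟨b, a, c⟩ h y hy hy'
      rw [mem_eightParam] at h
      simp only [eightDeck, revDropPos]
      split_ifs <;> simp <;> omega)
    (by
      rintro ⟨b, a, c⟩ - ⟨b', a', c'⟩ - y z π h h'
      simp only [eightDeck, List.mem_append, or_imp, forall_and, List.forall_mem_cons] at h h'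
      obtain ⟨⟨h0, h1, h2, h3, -⟩, -⟩ := h
      obtain ⟨⟨h0', h1', h2', h3', -⟩, -⟩ := h'
      obtain rfl : a = a' := h1.symm.trans h1'
      obtain rfl : b = b' := h2.symm.trans h2'
      obtain rfl : c = c' := h3.symm.trans h3'
      exact ⟨h0.symm.trans h0', rfl⟩)
    (by
      rintro ⟨b, a, c⟩ h y hy hy' π hπ
      exact minimalPeriod_of_eightDeck hy hy' h hπ)
  refine le_of_eq_of_le ?_ hle
  have h3 : (n - 4)! = (n - 5) * (n - 5)! + (n - 5)! := by
    rw [show n - 4 = n - 5 + 1 by omega, Nat.factorial_succ]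
    ring
  have hw (p : Σ _ : ℕ, ℕ × ℕ) : (n - if p.2.1 + p.1 + p.2.2 = n - 1 then 4 else 5)! =
      (if p.2.1 + p.1 + p.2.2 = n - 1 then (n - 5) * (n - 5)! else 0) + (n - 5)! := by
    split_ifs
    · exact h3
    · exact (Nat.zero_add _).symm
  simp only [hw]
  rw [Finset.sum_add_distrib, ← Finset.sum_filter, Finset.sum_const, Finset.sum_const,
    smul_eq_mul, smul_eq_mul]
  ring

/-! ### Assembling the counts -/

theorem mainTheorem1 (n : ℕ) :
    (2 ≤ n → numOrbits n 2 = (n - 2)!) ∧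
    numOrbits n 3 = 0 ∧
    (3 ≤ n → numOrbits n 4 = (n - 2)!) ∧
    (7 ≤ n →
      (Even n → numOrbits n 5 = (n - 6) * (n - 5)!) ∧
      (Odd n → numOrbits n 5 = (n - 5) * (n - 5)!)) ∧
    (4 ≤ n →
      (Even n →
        (2 * (n : ℚ) ^ 2 - 11 * n + 14) * ((n - 4)! : ℕ) ≤ (numOrbits n 6 : ℚ)) ∧
      (Odd n →
        (2 * (n : ℚ) ^ 2 - 12 * n + 18) * ((n - 4)! : ℕ) ≤ (numOrbits n 6 : ℚ))) ∧
    (5 ≤ n →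
      (n % 6 = 0 ∨ n % 6 = 2 →
        (3 / 2 * (n : ℚ) ^ 3 - 35 / 2 * (n : ℚ) ^ 2 + 64 * n - 70) * ((n - 5)! : ℕ)
          ≤ (numOrbits n 8 : ℚ)) ∧
      (n % 6 = 1 →
        (3 / 2 * (n : ℚ) ^ 3 - 35 / 2 * (n : ℚ) ^ 2 + 137 / 2 * n - 181 / 2) * ((n - 5)! : ℕ)
          ≤ (numOrbits n 8 : ℚ)) ∧
      (n % 6 = 3 ∨ n % 6 = 5 →
        (3 / 2 * (n : ℚ) ^ 3 - 35 / 2 * (n : ℚ) ^ 2 + 135 / 2 * n - 171 / 2) * ((n - 5)! : ℕ)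
          ≤ (numOrbits n 8 : ℚ)) ∧
      (n % 6 = 4 →
        (3 / 2 * (n : ℚ) ^ 3 - 35 / 2 * (n : ℚ) ^ 2 + 66 * n - 80) * ((n - 5)! : ℕ)
          ≤ (numOrbits n 8 : ℚ))) := by
  refine ⟨numOrbits_two, numOrbits_three n, numOrbits_four,
    fun hn => ?_, fun hn => ?_, fun hn => ?_⟩
  · rw [numOrbits_five hn]
    exact ⟨fun h => by rw [if_pos h], fun h => by rw [if_neg (Nat.not_even_iff_odd.2 h)]⟩
  · have h6 : _ ≤ (numOrbits n 6 : ℚ) := Nat.cast_le.2 (le_numOrbits_six hn)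
    obtain ⟨m, rfl⟩ := Nat.exists_eq_add_of_le' hn
    constructor
    · intro h
      refine le_of_eq_of_le ?_ h6
      rw [if_pos h]
      simp only [Nat.reduceSubDiff]
      push_cast
      ring
    · intro h
      refine le_of_eq_of_le ?_ h6
      rw [if_neg (Nat.not_even_iff_odd.2 h)]
      simp only [Nat.reduceSubDiff]
      push_cast
      ring
  · have h8 : _ ≤ (numOrbits n 8 : ℚ) := Nat.cast_le.2 (le_numOrbits_eight hn)
    have hC : (_ : ℚ) = _ := congrArg Nat.cast (card_eightParam hn)
    have hB : _ ≤ (_ : ℚ) := Nat.cast_le.2 (card_filter_eightParam (n := n) (by omega))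
    have key {q : ℚ} (h : q ≤ ((eightParam n).card : ℚ) + ((n - 5 : ℕ) : ℚ) *
        ({p ∈ eightParam n | p.2.1 + p.1 + p.2.2 = n - 1}).card) :
        q * ((n - 5)! : ℕ) ≤ (numOrbits n 8 : ℚ) := by
      push_cast at h8
      exact (mul_le_mul_of_nonneg_right h (Nat.cast_nonneg _)).trans h8
    generalize ({p ∈ eightParam n | p.2.1 + p.1 + p.2.2 = n - 1}).card = B at *
    clear h8
    rw [hC] at key
    -- The residue of `n` modulo six enters through parity, here and in `card_eightParam`, and
    -- through whether `3 ∣ n - 1`, in `hB`.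
    have h2 : ((2 * ((n - 2) / 2) : ℕ) : ℚ) = if Even n then (n : ℚ) - 2 else (n : ℚ) - 3 := by
      split_ifs with he
      · obtain ⟨k, hk⟩ := he
        rw [show 2 * ((n - 2) / 2) = n - 2 by omega, Nat.cast_sub (by omega)]
        rfl
      · obtain ⟨k, hk⟩ := Nat.not_even_iff_odd.1 he
        rw [show 2 * ((n - 2) / 2) = n - 3 by omega, Nat.cast_sub (by omega)]
        rfl
    have he : Even n ↔ n % 2 = 0 := Nat.even_iff
    simp only [he] at *
    obtain ⟨m, rfl⟩ := Nat.exists_eq_add_of_le' hn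
    simp only [Nat.reduceSubDiff, Nat.add_sub_cancel] at key hB
    push_cast at key hB h2
    have hm : (0 : ℚ) ≤ m := Nat.cast_nonneg m
    refine ⟨fun h => key ?_, fun h => key ?_, fun h => key ?_, fun h => key ?_⟩
    · rw [if_pos (by omega)] at h2 ⊢
      rw [if_neg (by omega)] at hB
      push_cast at hB ⊢
      -- In the bound, `B` has coefficient `n - 5 = m`, so `hB` is scaled by `m`.
      nlinarith [mul_le_mul_of_nonneg_left hB hm]
    · rw [if_neg (by omega)] at h2 ⊢
      rw [if_pos (by omega)] at hB
      push_cast at hB ⊢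
      nlinarith [mul_le_mul_of_nonneg_left hB hm]
    · rw [if_neg (by omega)] at h2 ⊢
      rw [if_neg (by omega)] at hB
      push_cast at hB ⊢
      nlinarith [mul_le_mul_of_nonneg_left hB hm]
    · rw [if_pos (by omega)] at h2 ⊢
      rw [if_pos (by omega)] at hB
      push_cast at hB ⊢
      nlinarith [mul_le_mul_of_nonneg_left hB hm]
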